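/- **Conventions.** A partially ordered group is a group $G$ with a partial order invariant under left and right multiplication; $G^+=\{a\in G\mid a\ge \mathrm e\}$. An $\ell$-group is a partially ordered group whose order is a lattice order; a variety of $\ell$-groups is a class of $\ell$-groups defined by a set of equations in the language of groups and lattices; $\ell$-homomorphisms are group homomorphisms that are lattice homomorphisms. For a chain $\Omega$, $\mathrm{Aut}(\Omega)$ is the $\ell$-group of its order-preserving bijections with pointwise order and with $f\cdot g$ meaning "$g$ after $f$". **Right pre-orders.** Let $G$ be a partially ordered group. A right pre-order on $G$ is (identified with) a proper submonoid $C\subsetneq G$ with $G=C\cup C^{-1}$ and $G^+\subseteq C$; its relation is $a\preceq_C b\iff ba^{-1}\in C$. It is a pre-order if $\preceq_C$ is also left invariant. Let $\Omega_C$ be the chain of classes $[a]$ of $G$ modulo ($a\preceq_C b$ and $b\preceq_C a$), ordered by $[a]\le[b]\iff a\preceq_C b$, let $R_C(a)\colon[b]\mapsto[ba]$, and let $H_C$ be the $\ell$-subgroup of $\mathrm{Aut}(\Omega_C)$ generated by $\{R_C(a)\mid a\in G\}$. For a variety $V$ of $\ell$-groups let $\mathcal P_V(G)$ be the set of right pre-orders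 $C$ on $G$ with $H_C\in V$, with the smallest topology containing the sets $\{C\mid a\in C,\ a^{-1}\notin C\}$, $a\in G$; let $\mathcal B_V(G)$ be its subspace of pre-orders. **Spectra.** For an $\ell$-group $H$, a convex $\ell$-subgroup is an order-convex sublattice subgroup $\mathfrak p$; its right cosets are ordered by $\mathfrak p x\le\mathfrak p y\iff x\le ty$ for some $t\in\mathfrak p$. It is prime if $\mathfrak p\ne H$ and this order is total. $\mathrm{Spec}\,H$ is the set of prime convex $\ell$-subgroups, with open sets $\{\mathfrak p\mid A\not\subseteq\mathfrak p\}$, $A\subseteq H$; $\mathrm{Spec}^*H$ is its subspace of normal members (prime ideals). **The maps.** Let $\eta\colon G\to F_V(G)$ be the universal order-preserving homomorphism from $G$ to the $\ell$-group free over $G$ in $V$. For $C\in\mathcal P_V(G)$ let $h_C\colon F_V(G)\to H_C$ be the unique $\ell$-homomorphism with $h_C\circ\eta=R_C$, and put $$\kappa(C)=\{x\in F_V(G)\mid h_C(x)([\mathrm e])=[\mathrm e]\}.$$ For $\mathfrak p\in\mathrm{Spec}\,F_V(G)$ put $a\preceq_{\mathfrak p}b\iff\mathfrak p\,\eta(a)\le\mathfrak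 p\,\eta(b)$ and $$\pi(\mathfrak p)=\{a\in G\mid \mathrm e\preceq_{\mathfrak p}a\}.$$ **Theorem 2.5.** For every partially ordered group $G$ and every variety $V$ of $\ell$-groups, these formulas give well-defined maps $\kappa\colon\mathcal P_V(G)\to\mathrm{Spec}\,F_V(G)$ and $\pi\colon\mathrm{Spec}\,F_V(G)\to\mathcal P_V(G)$ (and $\preceq_{\mathfrak p}$ is the relation of $\pi(\mathfrak p)$). They are mutually inverse, inclusion-preserving homeomorphisms, and they restrict to homeomorphisms between $\mathcal B_V(G)$ and $\mathrm{Spec}^*F_V(G)$. -/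

import Mathlib

universe u v

namespace LGrp

/-! ## Terms, varieties, homomorphisms, `ℓ`-subgroups

A partially ordered group is a type with `[Group G] [PartialOrder G] [MulLeftMono G]
[MulRightMono G]`; an `ℓ`-group is the same with `[Lattice H]` in place of `[PartialOrder G]`. -/

/-- Terms in the language of `ℓ`-groups with variables from `X`. -/
inductive LTerm (X : Type u) : Type u
  | var : X → LTerm X
  | one : LTerm X
  | mul : LTerm X → LTerm X → LTerm X
  | inv : LTerm X → LTerm X
  | sup : LTerm X → LTerm X → LTerm X
  | inf : LTerm X → LTerm X → LTerm X

/-- Value of a term under an assignment of its variables. -/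
def LTerm.eval {X : Type u} {H : Type v} [Group H] [Lattice H] (f : X → H) : LTerm X → H
  | .var x => f x
  | .one => 1
  | .mul s t => s.eval f * t.eval f
  | .inv s => (s.eval f)⁻¹
  | .sup s t => s.eval f ⊔ t.eval f
  | .inf s t => s.eval f ⊓ t.eval f

/-- Substitution of terms for the variables of a term. -/
def LTerm.subst {X : Type u} {Y : Type v} (σ : X → LTerm Y) : LTerm X → LTerm Y
  | .var x => σ x
  | .one => .one
  | .mul s t => .mul (s.subst σ) (t.subst σ)
  | .inv s => .inv (s.subst σ)
  | .sup s t => .sup (s.subst σ) (t.subst σ)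
  | .inf s t => .inf (s.subst σ) (t.subst σ)

/-- A set of equations between terms in countably many variables. A variety of `ℓ`-groups is
the class of all `ℓ`-groups that satisfy such a set of equations. -/
abbrev Equations : Type := Set (LTerm ℕ × LTerm ℕ)

/-- The `ℓ`-group `H` belongs to the variety axiomatised by `E`. -/
def InVariety (E : Equations) (H : Type v) [Group H] [Lattice H] : Prop :=
  ∀ e ∈ E, ∀ f : ℕ → H, e.1.eval f = e.2.eval f

/-- An `ℓ`-homomorphism: a group homomorphism that is also a lattice homomorphism. -/
structure LHom (H : Type u) (K : Type v) [Group H] [Lattice H] [Group K] [Lattice K]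
    extends H →* K where
  map_sup' : ∀ x y : H, toFun (x ⊔ y) = toFun x ⊔ toFun y
  map_inf' : ∀ x y : H, toFun (x ⊓ y) = toFun x ⊓ toFun y

instance LHom.instFunLike {H : Type u} {K : Type v} [Group H] [Lattice H] [Group K] [Lattice K] :
    FunLike (LHom H K) H K where
  coe h := h.toFun
  coe_injective h k e := by
    obtain ⟨⟨⟨f, _⟩, _⟩, _, _⟩ := h
    obtain ⟨⟨⟨g, _⟩, _⟩, _, _⟩ := k
    have hfg : f = g := e
    subst hfg
    rfl

/-- An `ℓ`-subgroup: a subgroup that is a sublattice. -/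
structure LSubgroup (H : Type u) [Group H] [Lattice H] extends Subgroup H where
  sup_mem' : ∀ {x y : H}, x ∈ carrier → y ∈ carrier → x ⊔ y ∈ carrier
  inf_mem' : ∀ {x y : H}, x ∈ carrier → y ∈ carrier → x ⊓ y ∈ carrier

section LSubgroup

variable {H : Type u} [Group H] [Lattice H]

instance LSubgroup.instSetLike : SetLike (LSubgroup H) H where
  coe K := K.carrier
  coe_injective K L e := by
    obtain ⟨K, _, _⟩ := K
    obtain ⟨L, _, _⟩ := L
    have hKL : K = L := SetLike.coe_injective e
    subst hKL
    rfl

instance LSubgroup.instSubgroupClass : SubgroupClass (LSubgroup H) H where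
  mul_mem {K} := K.toSubgroup.mul_mem
  one_mem K := K.toSubgroup.one_mem
  inv_mem {K} := K.toSubgroup.inv_mem

/-- The lattice structure inherited by an `ℓ`-subgroup. -/
instance LSubgroup.instLattice (K : LSubgroup H) : Lattice K :=
  Subtype.lattice (fun _ _ hx hy => K.sup_mem' hx hy) (fun _ _ hx hy => K.inf_mem' hx hy)

instance LSubgroup.instMulLeftMono [MulLeftMono H] (K : LSubgroup H) : MulLeftMono K where
  elim a b c h := by
    change (a : H) * (b : H) ≤ (a : H) * (c : H)
    have h' : (b : H) ≤ (c : H) := h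
    exact mul_le_mul_right h' _

instance LSubgroup.instMulRightMono [MulRightMono H] (K : LSubgroup H) : MulRightMono K where
  elim a b c h := by
    change (b : H) * (a : H) ≤ (c : H) * (a : H)
    have h' : (b : H) ≤ (c : H) := h
    exact mul_le_mul_left h' _

/-- The `ℓ`-subgroup generated by a set: the intersection of all `ℓ`-subgroups containing it. -/
def LSubgroup.closure (S : Set H) : LSubgroup H where
  carrier := {x | ∀ K : LSubgroup H, S ⊆ K → x ∈ K}
  mul_mem' hx hy K hK := mul_mem (hx K hK) (hy K hK)
  one_mem' K _ := one_mem K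
  inv_mem' hx K hK := inv_mem (hx K hK)
  sup_mem' hx hy K hK := K.sup_mem' (hx K hK) (hy K hK)
  inf_mem' hx hy K hK := K.inf_mem' (hx K hK) (hy K hK)

theorem LSubgroup.subset_closure (S : Set H) : S ⊆ LSubgroup.closure S :=
  fun _ hx _ hK => hK hx

end LSubgroup

/-! ## The `ℓ`-group of automorphisms of a chain -/

/-- The order-preserving bijections of a chain. -/
def ChainAut (Ω : Type u) [LinearOrder Ω] : Type u := Ω ≃o Ω

namespace ChainAut

variable {Ω : Type u} [LinearOrder Ω]

instance : FunLike (ChainAut Ω) Ω Ω where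
  coe f := (show Ω ≃o Ω from f).toFun
  coe_injective _ _ e := DFunLike.coe_injective (F := Ω ≃o Ω) e

theorem ext {f g : ChainAut Ω} (h : ∀ x, f x = g x) : f = g := DFunLike.ext f g h

/-- The product `f * g` is `g` after `f`. -/
instance : Group (ChainAut Ω) where
  mul f g := OrderIso.trans (show Ω ≃o Ω from f) (show Ω ≃o Ω from g)
  one := OrderIso.refl Ω
  inv f := OrderIso.symm (show Ω ≃o Ω from f)
  mul_assoc _ _ _ := rfl
  one_mul _ := rfl
  mul_one _ := rfl
  inv_mul_cancel f := ext fun x => (show Ω ≃o Ω from f).apply_symm_apply x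

theorem mul_apply (f g : ChainAut Ω) (x : Ω) : (f * g) x = g (f x) := rfl

theorem one_apply (x : Ω) : (1 : ChainAut Ω) x = x := rfl

theorem inv_apply_self (f : ChainAut Ω) (x : Ω) : f⁻¹ (f x) = x :=
  (show Ω ≃o Ω from f).symm_apply_apply x

theorem apply_inv_self (f : ChainAut Ω) (x : Ω) : f (f⁻¹ x) = x :=
  (show Ω ≃o Ω from f).apply_symm_apply x

theorem mono (f : ChainAut Ω) : Monotone f := (show Ω ≃o Ω from f).monotone

theorem sup_inf_inv (f g : ChainAut Ω) (x : Ω) :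
    f (f⁻¹ x ⊓ g⁻¹ x) ⊔ g (f⁻¹ x ⊓ g⁻¹ x) = x := by
  rw [f.mono.map_inf, g.mono.map_inf, apply_inv_self, apply_inv_self]
  rcases le_total (f⁻¹ x) (g⁻¹ x) with h | h
  · have h1 := f.mono h
    have h2 := g.mono h
    rw [apply_inv_self] at h1 h2
    rw [inf_eq_left.2 h1, inf_eq_left.2 h2, sup_eq_left.2 h2]
  · have h1 := f.mono h
    have h2 := g.mono h
    rw [apply_inv_self] at h1 h2
    rw [inf_eq_right.2 h1, inf_eq_right.2 h2, sup_eq_right.2 h1]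

theorem inf_sup_inv (f g : ChainAut Ω) (x : Ω) :
    f (f⁻¹ x ⊔ g⁻¹ x) ⊓ g (f⁻¹ x ⊔ g⁻¹ x) = x := by
  rw [f.mono.map_sup, g.mono.map_sup, apply_inv_self, apply_inv_self]
  rcases le_total (f⁻¹ x) (g⁻¹ x) with h | h
  · have h1 := f.mono h
    have h2 := g.mono h
    rw [apply_inv_self] at h1 h2
    rw [sup_eq_right.2 h1, sup_eq_right.2 h2, inf_eq_right.2 h1]
  · have h1 := f.mono h
    have h2 := g.mono h
    rw [apply_inv_self] at h1 h2
    rw [sup_eq_left.2 h1, sup_eq_left.2 h2, inf_eq_left.2 h2]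

/-- The pointwise supremum of two automorphisms. -/
def sup (f g : ChainAut Ω) : ChainAut Ω :=
  Equiv.toOrderIso
    { toFun := fun x => f x ⊔ g x
      invFun := fun x => f⁻¹ x ⊓ g⁻¹ x
      left_inv := fun x => by simpa using inf_sup_inv f⁻¹ g⁻¹ x
      right_inv := fun x => sup_inf_inv f g x }
    (fun _ _ h => sup_le_sup (f.mono h) (g.mono h))
    (fun _ _ h => inf_le_inf (f⁻¹.mono h) (g⁻¹.mono h))

/-- The pointwise infimum of two automorphisms. -/
def inf (f g : ChainAut Ω) : ChainAut Ω :=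
  Equiv.toOrderIso
    { toFun := fun x => f x ⊓ g x
      invFun := fun x => f⁻¹ x ⊔ g⁻¹ x
      left_inv := fun x => by simpa using sup_inf_inv f⁻¹ g⁻¹ x
      right_inv := fun x => inf_sup_inv f g x }
    (fun _ _ h => inf_le_inf (f.mono h) (g.mono h))
    (fun _ _ h => sup_le_sup (f⁻¹.mono h) (g⁻¹.mono h))

/-- The pointwise order and lattice operations. -/
instance : Lattice (ChainAut Ω) where
  le f g := ∀ x, f x ≤ g x
  le_refl f x := le_refl (f x)
  le_trans _ _ _ h k x := (h x).trans (k x)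
  le_antisymm _ _ h k := ext fun x => le_antisymm (h x) (k x)
  sup := sup
  inf := inf
  le_sup_left f g x := (le_sup_left : f x ≤ f x ⊔ g x)
  le_sup_right f g x := (le_sup_right : g x ≤ f x ⊔ g x)
  sup_le _ _ _ h k x := sup_le (h x) (k x)
  inf_le_left f g x := (inf_le_left : f x ⊓ g x ≤ f x)
  inf_le_right f g x := (inf_le_right : f x ⊓ g x ≤ g x)
  le_inf _ _ _ h k x := le_inf (h x) (k x)

theorem sup_apply (f g : ChainAut Ω) (x : Ω) : (f ⊔ g) x = f x ⊔ g x := rfl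

theorem inf_apply (f g : ChainAut Ω) (x : Ω) : (f ⊓ g) x = f x ⊓ g x := rfl

instance : MulLeftMono (ChainAut Ω) where
  elim f _ _ h x := h (f x)

instance : MulRightMono (ChainAut Ω) where
  elim f _ _ h x := f.mono (h x)

end ChainAut

/-! ## Right pre-orders and the right regular representation -/

/-- A right pre-order on the partially ordered group `G`, given by its positive cone: a proper
submonoid `C` of `G` with `G = C ∪ C⁻¹` and `G⁺ ⊆ C`. -/
structure PreCone (G : Type u) [Group G] [PartialOrder G] extends Submonoid G where
  proper' : carrier ≠ Set.univ
  total' : ∀ a : G, a ∈ carrier ∨ a⁻¹ ∈ carrier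
  pos_mem' : ∀ a : G, 1 ≤ a → a ∈ carrier

section PreCone

variable {G : Type u} [Group G] [PartialOrder G]

instance PreCone.instSetLike : SetLike (PreCone G) G where
  coe C := C.carrier
  coe_injective C D e := by
    obtain ⟨C, _, _, _⟩ := C
    obtain ⟨D, _, _, _⟩ := D
    have hCD : C = D := SetLike.coe_injective e
    subst hCD
    rfl

instance PreCone.instSubmonoidClass : SubmonoidClass (PreCone G) G where
  mul_mem {C} := C.toSubmonoid.mul_mem
  one_mem C := C.toSubmonoid.one_mem

namespace PreCone

variable (C : PreCone G)

/-- The relation `a ≼ b` on `G` with positive cone `C`. -/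
def Rel (a b : G) : Prop := b * a⁻¹ ∈ C

theorem rel_refl (a : G) : C.Rel a a := by
  unfold Rel
  rw [mul_inv_cancel]
  exact one_mem C

theorem rel_trans {a b c : G} (h : C.Rel a b) (k : C.Rel b c) : C.Rel a c := by
  have h' := mul_mem k h
  unfold Rel
  simpa [mul_assoc] using h'

theorem rel_total (a b : G) : C.Rel a b ∨ C.Rel b a := by
  have h := C.total' (b * a⁻¹)
  rw [mul_inv_rev, inv_inv] at h
  exact h

theorem rel_mul_right {a b : G} (t : G) (h : C.Rel a b) : C.Rel (a * t) (b * t) := by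
  unfold Rel at *
  simpa [mul_assoc] using h

theorem rel_mul_right_iff {a b : G} (t : G) : C.Rel (a * t) (b * t) ↔ C.Rel a b :=
  ⟨fun h => by simpa using C.rel_mul_right t⁻¹ h, C.rel_mul_right t⟩

/-- The right pre-order is a (two-sided) pre-order: it is also left invariant. -/
def IsPreorder : Prop := ∀ a b t : G, C.Rel a b → C.Rel (t * a) (t * b)

/-- The equivalence relation `a ≼ b` and `b ≼ a`. -/
def setoid : Setoid G where
  r a b := C.Rel a b ∧ C.Rel b a
  iseqv :=
    { refl := fun a => ⟨C.rel_refl a, C.rel_refl a⟩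
      symm := fun h => ⟨h.2, h.1⟩
      trans := fun h k => ⟨C.rel_trans h.1 k.1, C.rel_trans k.2 h.2⟩ }

/-- The chain of equivalence classes of the right pre-order. -/
def Omega : Type u := Quotient C.setoid

/-- The class of `a`. -/
def cls (a : G) : C.Omega := Quotient.mk C.setoid a

/-- The class of `a` is below the class of `b` if and only if `a ≼ b`. -/
noncomputable instance : LinearOrder C.Omega where
  le := Quotient.lift₂ (s₁ := C.setoid) (s₂ := C.setoid) C.Rel (fun _ _ _ _ h k =>
    propext ⟨fun e => C.rel_trans h.2 (C.rel_trans e k.1),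
      fun e => C.rel_trans h.1 (C.rel_trans e k.2)⟩)
  le_refl := by
    rintro ⟨a⟩
    exact C.rel_refl a
  le_trans := by
    rintro ⟨a⟩ ⟨b⟩ ⟨c⟩ h k
    exact C.rel_trans h k
  le_antisymm := by
    rintro ⟨a⟩ ⟨b⟩ h k
    exact Quotient.sound (s := C.setoid) ⟨h, k⟩
  le_total := by
    rintro ⟨a⟩ ⟨b⟩
    exact C.rel_total a b
  toDecidableLE := Classical.decRel _

theorem cls_le_cls (a b : G) : C.cls a ≤ C.cls b ↔ C.Rel a b := Iff.rfl

/-- The map on classes that sends the class of `b` to the class of `b * a`. -/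
def mulRight (a : G) : C.Omega → C.Omega :=
  Quotient.lift (s := C.setoid) (fun b => C.cls (b * a)) (fun _ _ h =>
    Quotient.sound (s := C.setoid) ⟨C.rel_mul_right a h.1, C.rel_mul_right a h.2⟩)

theorem mulRight_mul (a b : G) (x : C.Omega) :
    C.mulRight b (C.mulRight a x) = C.mulRight (a * b) x := by
  obtain ⟨c⟩ := x
  change C.cls (c * a * b) = C.cls (c * (a * b))
  rw [mul_assoc]

theorem mulRight_one (x : C.Omega) : C.mulRight 1 x = x := by
  obtain ⟨c⟩ := x
  change C.cls (c * 1) = C.cls c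
  rw [mul_one]

theorem mulRight_mono (a : G) : Monotone (C.mulRight a) := by
  rintro ⟨b⟩ ⟨c⟩ h
  exact C.rel_mul_right a h

/-- The automorphism of the chain of classes that sends the class of `b` to that of `b * a`. -/
noncomputable def rhoFun (a : G) : ChainAut C.Omega :=
  Equiv.toOrderIso
    { toFun := C.mulRight a
      invFun := C.mulRight a⁻¹
      left_inv := fun x => by rw [mulRight_mul, mul_inv_cancel, mulRight_one]
      right_inv := fun x => by rw [mulRight_mul, inv_mul_cancel, mulRight_one] }
    (C.mulRight_mono a) (C.mulRight_mono a⁻¹)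

/-- The homomorphism from `G` to the automorphisms of the chain of classes. -/
noncomputable def rho : G →* ChainAut C.Omega where
  toFun := C.rhoFun
  map_one' := ChainAut.ext fun x => C.mulRight_one x
  map_mul' a b := ChainAut.ext fun x => (C.mulRight_mul a b x).symm

theorem rho_apply (a b : G) : C.rho a (C.cls b) = C.cls (b * a) := rfl

/-- The `ℓ`-subgroup of the automorphisms of the chain of classes generated by the image
of `G`. -/
noncomputable def HSub : LSubgroup (ChainAut C.Omega) := LSubgroup.closure (Set.range C.rho)

variable [MulLeftMono G] [MulRightMono G]

theorem rho_mono : Monotone C.rho := by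
  rintro a b h ⟨c⟩
  apply C.pos_mem'
  have h1 : c * a ≤ c * b := mul_le_mul_right h c
  have h2 := mul_le_mul_left h1 (c * a)⁻¹
  rwa [mul_inv_cancel] at h2

/-- The right regular representation, as a positive homomorphism. -/
noncomputable def R : G →*o C.HSub where
  toFun a := ⟨C.rho a, LSubgroup.subset_closure _ ⟨a, rfl⟩⟩
  map_one' := Subtype.ext C.rho.map_one
  map_mul' a b := Subtype.ext (C.rho.map_mul a b)
  monotone' _ _ h := C.rho_mono h

end PreCone

/-- The space of right pre-orders `C` on `G` whose right regular representation has its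
`ℓ`-group `C.HSub` in the variety axiomatised by `E`. -/
def RightPreorders (E : Equations) (G : Type u) [Group G] [PartialOrder G] : Type u :=
  {C : PreCone G // InVariety E C.HSub}

/-- The set of right pre-orders in which `a` is strictly positive. -/
def RightPreorders.basicOpen (E : Equations) (a : G) : Set (RightPreorders E G) :=
  {C | a ∈ C.1 ∧ a⁻¹ ∉ C.1}

/-- The smallest topology in which all sets `basicOpen E a` are open. -/
instance (E : Equations) : TopologicalSpace (RightPreorders E G) :=
  TopologicalSpace.generateFrom (Set.range (RightPreorders.basicOpen E))

end PreCone

/-- The subset of (two-sided) pre-orders; as a type it carries the subspace topology. -/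
def Preorders (E : Equations) (G : Type u) [Group G] [PartialOrder G] :
    Set (RightPreorders E G) :=
  {C | C.1.IsPreorder}

/-! ## The spectrum of an `ℓ`-group -/

/-- A convex `ℓ`-subgroup. -/
structure ConvexLSubgroup (H : Type u) [Group H] [Lattice H] extends LSubgroup H where
  convex' : ∀ {x y z : H}, x ∈ carrier → y ∈ carrier → x ≤ z → z ≤ y → z ∈ carrier

section Spectrum

variable {H : Type u} [Group H] [Lattice H]

instance ConvexLSubgroup.instSetLike : SetLike (ConvexLSubgroup H) H where
  coe K := K.carrier
  coe_injective K L e := by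
    obtain ⟨K, _⟩ := K
    obtain ⟨L, _⟩ := L
    have hKL : K = L := SetLike.coe_injective e
    subst hKL
    rfl

instance ConvexLSubgroup.instSubgroupClass : SubgroupClass (ConvexLSubgroup H) H where
  mul_mem {K} := K.toSubgroup.mul_mem
  one_mem K := K.toSubgroup.one_mem
  inv_mem {K} := K.toSubgroup.inv_mem

/-- The set of right cosets `K x` of a convex `ℓ`-subgroup `K`. -/
def ConvexLSubgroup.Cosets (K : ConvexLSubgroup H) : Type u :=
  Quotient (QuotientGroup.rightRel K.toSubgroup)

/-- The right coset `K x`. -/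
def ConvexLSubgroup.coset (K : ConvexLSubgroup H) (x : H) : K.Cosets :=
  Quotient.mk (QuotientGroup.rightRel K.toSubgroup) x

/-- Two elements have the same coset if and only if they differ by a left factor from `K`. -/
theorem ConvexLSubgroup.coset_eq (K : ConvexLSubgroup H) (x y : H) :
    K.coset x = K.coset y ↔ y * x⁻¹ ∈ K :=
  (Quotient.eq (r := QuotientGroup.rightRel K.toSubgroup)).trans QuotientGroup.rightRel_apply

theorem ConvexLSubgroup.le_aux [MulLeftMono H] (K : ConvexLSubgroup H) {x y x' y' : H} (hx : x' * x⁻¹ ∈ K)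
    (hy : y' * y⁻¹ ∈ K) (h : ∃ t ∈ K, x ≤ t * y) : ∃ t ∈ K, x' ≤ t * y' := by
  obtain ⟨t, ht, hle⟩ := h
  refine ⟨x' * x⁻¹ * t * (y' * y⁻¹)⁻¹, mul_mem (mul_mem hx ht) (inv_mem hy), ?_⟩
  have h1 := mul_le_mul_right hle (x' * x⁻¹)
  simpa [mul_assoc] using h1

variable [MulLeftMono H]

/-- The order on right cosets: `K x ≤ K y` if and only if `x ≤ t y` for some `t ∈ K`. -/
instance (K : ConvexLSubgroup H) : LE K.Cosets where
  le := Quotient.lift₂ (s₁ := QuotientGroup.rightRel K.toSubgroup)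
    (s₂ := QuotientGroup.rightRel K.toSubgroup) (fun x y => ∃ t ∈ K, x ≤ t * y)
    (fun _ _ _ _ h k => by
      have h1 := QuotientGroup.rightRel_apply.1 h
      have k1 := QuotientGroup.rightRel_apply.1 k
      have h2 := QuotientGroup.rightRel_apply.1 (Setoid.symm' _ h)
      have k2 := QuotientGroup.rightRel_apply.1 (Setoid.symm' _ k)
      exact propext ⟨K.le_aux h1 k1, K.le_aux h2 k2⟩)

theorem ConvexLSubgroup.coset_le_coset (K : ConvexLSubgroup H) (x y : H) :
    K.coset x ≤ K.coset y ↔ ∃ t ∈ K, x ≤ t * y := Iff.rfl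

/-- A convex `ℓ`-subgroup is prime if it is proper and its cosets are totally ordered. -/
def ConvexLSubgroup.IsPrime (K : ConvexLSubgroup H) : Prop :=
  (K : Set H) ≠ Set.univ ∧ ∀ X Y : K.Cosets, X ≤ Y ∨ Y ≤ X

variable [MulRightMono H]

variable (H) in
/-- The set of prime subgroups of `H`. -/
def Spec : Type u := {K : ConvexLSubgroup H // K.IsPrime}

/-- The set of prime subgroups that do not include `A`. -/
def Spec.support (A : Set H) : Set (Spec H) := {p | ¬ A ⊆ (p.1 : Set H)}

theorem ConvexLSubgroup.mabs_mem_iff (K : ConvexLSubgroup H) (a : H) : |a|ₘ ∈ K ↔ a ∈ K := by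
  constructor
  · intro h
    exact K.convex' (inv_mem h) h (inv_le_of_inv_le' (inv_le_mabs a)) (le_mabs_self a)
  · intro h
    exact K.sup_mem' h (inv_mem h)

theorem ConvexLSubgroup.IsPrime.mem_of_inf {K : ConvexLSubgroup H} (hK : K.IsPrime) {a b : H}
    (h : |a|ₘ ⊓ |b|ₘ ∈ K) : a ∈ K ∨ b ∈ K := by
  have key : ∀ c d : H, |c|ₘ ⊓ |d|ₘ ∈ K → K.coset |c|ₘ ≤ K.coset |d|ₘ → c ∈ K := by
    rintro c d hm ⟨t, ht, hle⟩
    have hT : |t|ₘ ∈ K := (K.mabs_mem_iff t).2 ht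
    have h1 : |c|ₘ ≤ |t|ₘ * (|c|ₘ ⊓ |d|ₘ) := by
      rw [mul_inf]
      refine le_inf ?_ (hle.trans (mul_le_mul_left (le_mabs_self t) _))
      have := mul_le_mul_left (one_le_mabs t) |c|ₘ
      rwa [one_mul] at this
    exact (K.mabs_mem_iff c).1 (K.convex' (one_mem K) (mul_mem hT hm) (one_le_mabs c) h1)
  rcases hK.2 (K.coset |a|ₘ) (K.coset |b|ₘ) with h1 | h1
  · exact Or.inl (key a b h h1)
  · exact Or.inr (key b a (by rwa [inf_comm]) h1)

/-- The spectral topology: the open sets are exactly the sets `Spec.support A`. -/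
instance : TopologicalSpace (Spec H) where
  IsOpen U := ∃ A : Set H, U = Spec.support A
  isOpen_univ := by
    refine ⟨Set.univ, ?_⟩
    ext p
    simpa [Spec.support, Set.univ_subset_iff] using p.2.1
  isOpen_inter := by
    rintro _ _ ⟨A, rfl⟩ ⟨B, rfl⟩
    refine ⟨{x | ∃ a ∈ A, ∃ b ∈ B, x = |a|ₘ ⊓ |b|ₘ}, ?_⟩
    ext p
    constructor
    · rintro ⟨h1, h2⟩
      obtain ⟨a, ha, ha'⟩ := Set.not_subset.1 h1
      obtain ⟨b, hb, hb'⟩ := Set.not_subset.1 h2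
      refine Set.not_subset.2 ⟨_, ⟨a, ha, b, hb, rfl⟩, fun hm => ?_⟩
      rcases p.2.mem_of_inf hm with h | h
      · exact ha' h
      · exact hb' h
    · intro hp
      obtain ⟨_, ⟨a, ha, b, hb, rfl⟩, hm⟩ := Set.not_subset.1 hp
      have h1 : (1 : H) ≤ |a|ₘ ⊓ |b|ₘ := le_inf (one_le_mabs a) (one_le_mabs b)
      refine ⟨Set.not_subset.2 ⟨a, ha, fun h => hm ?_⟩,
        Set.not_subset.2 ⟨b, hb, fun h => hm ?_⟩⟩
      · exact p.1.convex' (one_mem p.1) ((p.1.mabs_mem_iff a).2 h) h1 inf_le_left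
      · exact p.1.convex' (one_mem p.1) ((p.1.mabs_mem_iff b).2 h) h1 inf_le_right
  isOpen_sUnion := by
    intro S hS
    refine ⟨{x | ∃ A : Set H, Spec.support A ∈ S ∧ x ∈ A}, ?_⟩
    ext p
    constructor
    · rintro ⟨U, hU, hp⟩
      obtain ⟨A, rfl⟩ := hS U hU
      obtain ⟨x, hx, hx'⟩ := Set.not_subset.1 hp
      exact Set.not_subset.2 ⟨x, ⟨A, hU, hx⟩, hx'⟩
    · intro hp
      obtain ⟨x, ⟨A, hA, hx⟩, hx'⟩ := Set.not_subset.1 hp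
      exact ⟨_, hA, Set.not_subset.2 ⟨x, hx, hx'⟩⟩

variable (H) in
/-- The subset of prime ideals, that is, of normal prime subgroups; as a type it carries the
subspace topology. -/
def SpecStar : Set (Spec H) := {p | p.1.toSubgroup.Normal}

end Spectrum

/-! ## The free `ℓ`-group over a partially ordered group in a variety -/

section Free

variable {G : Type u} [Group G] [PartialOrder G]

/-- The congruence on terms over `G` generated by the axioms of `ℓ`-groups, by all instances of
the equations in `E`, and by the products and the order relations that hold in `G`. -/
inductive FreeRel (E : Equations) : LTerm G → LTerm G → Prop
  | refl (s) : FreeRel E s s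
  | symm {s t} : FreeRel E s t → FreeRel E t s
  | trans {s t r} : FreeRel E s t → FreeRel E t r → FreeRel E s r
  | mul_congr {s s' t t'} : FreeRel E s s' → FreeRel E t t' → FreeRel E (.mul s t) (.mul s' t')
  | inv_congr {s s'} : FreeRel E s s' → FreeRel E (.inv s) (.inv s')
  | sup_congr {s s' t t'} : FreeRel E s s' → FreeRel E t t' → FreeRel E (.sup s t) (.sup s' t')
  | inf_congr {s s' t t'} : FreeRel E s s' → FreeRel E t t' → FreeRel E (.inf s t) (.inf s' t')
  | mul_assoc (s t r) : FreeRel E (.mul (.mul s t) r) (.mul s (.mul t r))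
  | one_mul (s) : FreeRel E (.mul .one s) s
  | mul_one (s) : FreeRel E (.mul s .one) s
  | inv_mul (s) : FreeRel E (.mul (.inv s) s) .one
  | sup_comm (s t) : FreeRel E (.sup s t) (.sup t s)
  | sup_assoc (s t r) : FreeRel E (.sup (.sup s t) r) (.sup s (.sup t r))
  | inf_comm (s t) : FreeRel E (.inf s t) (.inf t s)
  | inf_assoc (s t r) : FreeRel E (.inf (.inf s t) r) (.inf s (.inf t r))
  | sup_inf_self (s t) : FreeRel E (.sup s (.inf s t)) s
  | inf_sup_self (s t) : FreeRel E (.inf s (.sup s t)) s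
  | mul_sup (s t r) : FreeRel E (.mul s (.sup t r)) (.sup (.mul s t) (.mul s r))
  | sup_mul (s t r) : FreeRel E (.mul (.sup s t) r) (.sup (.mul s r) (.mul t r))
  | equation (e) (he : e ∈ E) (σ : ℕ → LTerm G) : FreeRel E (e.1.subst σ) (e.2.subst σ)
  | var_mul (a b : G) : FreeRel E (.var (a * b)) (.mul (.var a) (.var b))
  | var_le (a b : G) (h : a ≤ b) : FreeRel E (.sup (.var a) (.var b)) (.var b)

/-- The congruence as a setoid. -/
def FreeRel.setoid (E : Equations) (G : Type u) [Group G] [PartialOrder G] :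
    Setoid (LTerm G) where
  r := FreeRel E
  iseqv := ⟨.refl, .symm, .trans⟩

/-- The `ℓ`-group freely generated by the partially ordered group `G` in the variety axiomatised
by `E`. -/
def FreeLGroup (E : Equations) (G : Type u) [Group G] [PartialOrder G] : Type u :=
  Quotient (FreeRel.setoid E G)

namespace FreeLGroup

variable {E : Equations}

/-- The class of a term. -/
def mk (E : Equations) (s : LTerm G) : FreeLGroup E G := Quotient.mk (FreeRel.setoid E G) s

theorem sound {s t : LTerm G} (h : FreeRel E s t) : mk E s = mk E t :=
  Quotient.sound (s := FreeRel.setoid E G) h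

instance : Mul (FreeLGroup E G) where
  mul := Quotient.map₂ (sa := FreeRel.setoid E G) (sb := FreeRel.setoid E G)
    (sc := FreeRel.setoid E G) LTerm.mul (fun _ _ h _ _ k => FreeRel.mul_congr h k)

instance : Max (FreeLGroup E G) where
  max := Quotient.map₂ (sa := FreeRel.setoid E G) (sb := FreeRel.setoid E G)
    (sc := FreeRel.setoid E G) LTerm.sup (fun _ _ h _ _ k => FreeRel.sup_congr h k)

instance : Min (FreeLGroup E G) where
  min := Quotient.map₂ (sa := FreeRel.setoid E G) (sb := FreeRel.setoid E G)
    (sc := FreeRel.setoid E G) LTerm.inf (fun _ _ h _ _ k => FreeRel.inf_congr h k)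

instance : Inv (FreeLGroup E G) where
  inv := Quotient.map (sa := FreeRel.setoid E G) (sb := FreeRel.setoid E G) LTerm.inv
    (fun _ _ h => FreeRel.inv_congr h)

instance : One (FreeLGroup E G) where
  one := mk E .one

instance : Group (FreeLGroup E G) where
  mul_assoc := by
    rintro ⟨s⟩ ⟨t⟩ ⟨r⟩
    exact sound (.mul_assoc s t r)
  one_mul := by
    rintro ⟨s⟩
    exact sound (.one_mul s)
  mul_one := by
    rintro ⟨s⟩
    exact sound (.mul_one s)
  inv_mul_cancel := by
    rintro ⟨s⟩
    exact sound (.inv_mul s)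

/-- Auxiliary form of the lattice structure below. -/
@[reducible]
def latticeAux (E : Equations) (G : Type u) [Group G] [PartialOrder G] :
    Lattice (FreeLGroup E G) :=
  Lattice.mk'
    (by rintro ⟨s⟩ ⟨t⟩; exact sound (.sup_comm s t))
    (by rintro ⟨s⟩ ⟨t⟩ ⟨r⟩; exact sound (.sup_assoc s t r))
    (by rintro ⟨s⟩ ⟨t⟩; exact sound (.inf_comm s t))
    (by rintro ⟨s⟩ ⟨t⟩ ⟨r⟩; exact sound (.inf_assoc s t r))
    (by rintro ⟨s⟩ ⟨t⟩; exact sound (.sup_inf_self s t))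
    (by rintro ⟨s⟩ ⟨t⟩; exact sound (.inf_sup_self s t))

/-- The lattice structure of the free `ℓ`-group; `x ≤ y` means `x ⊔ y = y`. -/
instance : Lattice (FreeLGroup E G) where
  le x y := x ⊔ y = y
  le_refl := (latticeAux E G).le_refl
  le_trans := (latticeAux E G).le_trans
  le_antisymm := (latticeAux E G).le_antisymm
  sup x y := x ⊔ y
  inf x y := x ⊓ y
  le_sup_left := (latticeAux E G).le_sup_left
  le_sup_right := (latticeAux E G).le_sup_right
  sup_le := (latticeAux E G).sup_le
  inf_le_left := (latticeAux E G).inf_le_left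
  inf_le_right := (latticeAux E G).inf_le_right
  le_inf := (latticeAux E G).le_inf

instance : MulLeftMono (FreeLGroup E G) where
  elim := by
    rintro ⟨s⟩ ⟨t⟩ ⟨r⟩ h
    change mk E s * mk E t ≤ mk E s * mk E r
    have h' : mk E t ⊔ mk E r = mk E r := sup_eq_right.2 h
    have e : mk E s * (mk E t ⊔ mk E r) = mk E s * mk E t ⊔ mk E s * mk E r :=
      sound (.mul_sup s t r)
    rw [h'] at e
    exact sup_eq_right.1 e.symm

instance : MulRightMono (FreeLGroup E G) where
  elim := by
    rintro ⟨s⟩ ⟨t⟩ ⟨r⟩ h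
    change mk E t * mk E s ≤ mk E r * mk E s
    have h' : mk E t ⊔ mk E r = mk E r := sup_eq_right.2 h
    have e : (mk E t ⊔ mk E r) * mk E s = mk E t * mk E s ⊔ mk E r * mk E s :=
      sound (.sup_mul t r s)
    rw [h'] at e
    exact sup_eq_right.1 e.symm

/-- The universal positive homomorphism from `G` to the free `ℓ`-group. -/
def eta (E : Equations) (G : Type u) [Group G] [PartialOrder G] : G →*o FreeLGroup E G where
  toFun a := mk E (.var a)
  map_one' := by
    have h : mk E (.var (1 : G)) * mk E (.var 1) = mk E (.var 1) := by
      have h1 : mk E (.var ((1 : G) * 1)) = mk E (.var 1) * mk E (.var 1) := sound (.var_mul 1 1)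
      rw [mul_one] at h1
      exact h1.symm
    exact mul_eq_left.1 h
  map_mul' a b := sound (.var_mul a b)
  monotone' a b h := by
    change mk E (.var a) ≤ mk E (.var b)
    have e : mk E (.var a) ⊔ mk E (.var b) = mk E (.var b) := sound (.var_le a b h)
    exact sup_eq_right.1 e

theorem eval_mk {X : Type v} (σ : X → LTerm G) (s : LTerm X) :
    s.eval (fun x => mk E (σ x)) = mk E (s.subst σ) := by
  induction s with
  | var x => rfl
  | one => rfl
  | mul s t hs ht => simp only [LTerm.eval, hs, ht]; rfl
  | inv s hs => simp only [LTerm.eval, hs]; rfl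
  | sup s t hs ht => simp only [LTerm.eval, hs, ht]; rfl
  | inf s t hs ht => simp only [LTerm.eval, hs, ht]; rfl

/-- The free `ℓ`-group belongs to the variety. -/
theorem inVariety (E : Equations) (G : Type u) [Group G] [PartialOrder G] :
    InVariety E (FreeLGroup E G) := by
  intro e he f
  choose σ hσ using fun n => Quotient.exists_rep (f n)
  have hf : f = fun n => mk E (σ n) := funext fun n => (hσ n).symm
  rw [hf, eval_mk, eval_mk]
  exact sound (.equation e he σ)

section Lift

variable {H : Type v} [Group H] [Lattice H]

theorem eval_subst {X : Type u} {Y : Type*} (f : Y → H) (σ : X → LTerm Y) (s : LTerm X) :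
    (s.subst σ).eval f = s.eval (fun x => (σ x).eval f) := by
  induction s with
  | var x => rfl
  | one => rfl
  | mul s t hs ht => simp only [LTerm.eval, LTerm.subst, hs, ht]
  | inv s hs => simp only [LTerm.eval, LTerm.subst, hs]
  | sup s t hs ht => simp only [LTerm.eval, LTerm.subst, hs, ht]
  | inf s t hs ht => simp only [LTerm.eval, LTerm.subst, hs, ht]

variable [MulLeftMono H] [MulRightMono H]

theorem eval_eq_of_rel (hH : InVariety E H) (p : G →*o H) {s t : LTerm G} (h : FreeRel E s t) :
    s.eval p = t.eval p := by
  induction h with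
  | refl => rfl
  | symm _ h => exact h.symm
  | trans _ _ h k => exact h.trans k
  | mul_congr _ _ h k => simp only [LTerm.eval, h, k]
  | inv_congr _ h => simp only [LTerm.eval, h]
  | sup_congr _ _ h k => simp only [LTerm.eval, h, k]
  | inf_congr _ _ h k => simp only [LTerm.eval, h, k]
  | mul_assoc => exact _root_.mul_assoc _ _ _
  | one_mul => exact _root_.one_mul _
  | mul_one => exact _root_.mul_one _
  | inv_mul => exact inv_mul_cancel _
  | sup_comm => exact _root_.sup_comm _ _
  | sup_assoc => exact _root_.sup_assoc _ _ _
  | inf_comm => exact _root_.inf_comm _ _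
  | inf_assoc => exact _root_.inf_assoc _ _ _
  | sup_inf_self => exact _root_.sup_inf_self
  | inf_sup_self => exact _root_.inf_sup_self
  | mul_sup => exact _root_.mul_sup _ _ _
  | sup_mul => exact _root_.sup_mul _ _ _
  | equation e he σ =>
    rw [eval_subst, eval_subst]
    exact hH e he _
  | var_mul a b => exact map_mul p a b
  | var_le a b h => exact sup_eq_right.2 (OrderHomClass.mono p h)

/-- The `ℓ`-homomorphism out of the free `ℓ`-group induced by a positive homomorphism `p` from
`G` to an `ℓ`-group in the variety. -/
def lift (hH : InVariety E H) (p : G →*o H) : LHom (FreeLGroup E G) H where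
  toFun := Quotient.lift (s := FreeRel.setoid E G) (LTerm.eval p)
    (fun _ _ h => eval_eq_of_rel hH p h)
  map_one' := rfl
  map_mul' := by
    rintro ⟨s⟩ ⟨t⟩
    rfl
  map_sup' := by
    rintro ⟨s⟩ ⟨t⟩
    rfl
  map_inf' := by
    rintro ⟨s⟩ ⟨t⟩
    rfl

/-- The universal property of the free `ℓ`-group. -/
theorem lift_unique (hH : InVariety E H) (p : G →*o H) (h : LHom (FreeLGroup E G) H) :
    (∀ a : G, h (eta E G a) = p a) ↔ h = lift hH p := by
  constructor
  · intro hp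
    apply DFunLike.ext
    rintro ⟨s⟩
    change h (mk E s) = s.eval p
    induction s with
    | var a => exact hp a
    | one => exact h.map_one'
    | mul s t hs ht => exact (h.map_mul' (mk E s) (mk E t)).trans (congrArg₂ _ hs ht)
    | inv s hs => exact (h.toMonoidHom.map_inv (mk E s)).trans (congrArg _ hs)
    | sup s t hs ht => exact (h.map_sup' (mk E s) (mk E t)).trans (congrArg₂ _ hs ht)
    | inf s t hs ht => exact (h.map_inf' (mk E s) (mk E t)).trans (congrArg₂ _ hs ht)
  · rintro rfl a
    rfl

end Lift

end FreeLGroup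

end Free

/-! ## The two correspondences -/

section Maps

variable {G : Type u} [Group G] [PartialOrder G] [MulLeftMono G] [MulRightMono G]

/-- The `ℓ`-homomorphism from the free `ℓ`-group to `C.HSub` that extends the right regular
representation of `C`. -/
noncomputable def RightPreorders.hom {E : Equations} (C : RightPreorders E G) :
    LHom (FreeLGroup E G) C.1.HSub :=
  FreeLGroup.lift C.2 C.1.R

/-- The underlying set of `κ(C)`: the preimage of the stabiliser of the class of the identity. -/
def kappaSet {E : Equations} (C : RightPreorders E G) : Set (FreeLGroup E G) :=
  {x | (C.hom x : ChainAut C.1.Omega) (C.1.cls 1) = C.1.cls 1}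

/-- The relation `p η(a) ≤ p η(b)` on `G`. -/
def piRel {E : Equations} (p : Spec (FreeLGroup E G)) (a b : G) : Prop :=
  p.1.coset (FreeLGroup.eta E G a) ≤ p.1.coset (FreeLGroup.eta E G b)

/-- The underlying set of `π(p)`: the positive cone of the relation `piRel p`. -/
def piSet {E : Equations} (p : Spec (FreeLGroup E G)) : Set G := {a | piRel p 1 a}

end Maps

end LGrp

open LGrp

/-! Because `η(G)` is a subgroup and multiplication distributes over `⊔` and `⊓`, every element of
the free `ℓ`-group `F` is a lattice word in elements `η(a)` (`inLattice`). Most statements about `F`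
therefore follow by induction over lattice words, and on a chain both operations merely select one
of two points.

A right pre-order `C` makes `F` act on the chain of classes, and `κ(C)` is the stabiliser of `[1]`.
Its cosets are ordered as the orbit points are (`stabilizer_coset_le`), so it is prime. Comparing
cosets of `η(1)` and `η(a)` then amounts to comparing `[1]` and `[a]`, so `π` undoes `κ`.

Conversely, a prime `p` orders `G` through the cosets `p η(a)`. The main difficulty is that the
resulting `ℓ`-group of automorphisms lies in the variety. The relation `Acts` matches `x` in `F`
with the automorphism of classes given by right multiplication by `x` on cosets. It respects all
operations, reaches every member of `HSub`, and determines the automorphism from `x`; hence each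
equation true in `F` passes to `HSub` (`inVariety_toPreCone`). The same relation shows that the
stabiliser built from `π(p)` is `p` again.

Continuity of `π` comes from translating strict positivity of `a` into `η(a) ⊔ 1 ∉ p`; continuity of
`κ` comes from an induction over lattice words (`isOpen_orbit`). Two-sided pre-orders match normal
primes because left translations then commute with the action, so the stabiliser of `[1]` acts
trivially. -/

namespace LGrp

/-! ### Lattice generation of the free `ℓ`-group by `G` -/

section FreeGeneration

variable {G : Type u} [Group G] [PartialOrder G] {E : Equations}

namespace FreeLGroup

/-! The operations of the free `ℓ`-group come from its own instances, not from its lattice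
structure, so that the general laws have to be restated for rewriting. -/

theorem mul_sup_eq (x y z : FreeLGroup E G) : x * (y ⊔ z) = x * y ⊔ x * z :=
  _root_.mul_sup _ _ _

theorem mul_inf_eq (x y z : FreeLGroup E G) : x * (y ⊓ z) = x * y ⊓ x * z :=
  _root_.mul_inf _ _ _

theorem sup_mul_eq (x y z : FreeLGroup E G) : (x ⊔ y) * z = x * z ⊔ y * z :=
  _root_.sup_mul x y z

theorem inf_mul_eq (x y z : FreeLGroup E G) : (x ⊓ y) * z = x * z ⊓ y * z :=
  _root_.inf_mul x y z

theorem inv_sup_eq (x y : FreeLGroup E G) : (x ⊔ y)⁻¹ = x⁻¹ ⊓ y⁻¹ := inv_sup x y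

theorem inv_inf_eq (x y : FreeLGroup E G) : (x ⊓ y)⁻¹ = x⁻¹ ⊔ y⁻¹ := inv_inf x y

/-- Membership in the sublattice generated by the image of `G`. -/
inductive InLattice : FreeLGroup E G → Prop
  | eta (a : G) : InLattice (eta E G a)
  | sup {x y : FreeLGroup E G} : InLattice x → InLattice y → InLattice (x ⊔ y)
  | inf {x y : FreeLGroup E G} : InLattice x → InLattice y → InLattice (x ⊓ y)

theorem InLattice.inv {x : FreeLGroup E G} (hx : InLattice x) : InLattice x⁻¹ := by
  induction hx with
  | eta a =>
    rw [← map_inv]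
    exact .eta _
  | sup _ _ hx hy =>
    rw [inv_sup_eq]
    exact hx.inf hy
  | inf _ _ hx hy =>
    rw [inv_inf_eq]
    exact hx.sup hy

/-- Two-sided distributivity pushes a product down to products `η(a) η(b) = η(ab)`. -/
theorem InLattice.mul {x y : FreeLGroup E G} (hx : InLattice x) (hy : InLattice y) :
    InLattice (x * y) := by
  induction hx with
  | eta a =>
    induction hy with
    | eta b =>
      rw [← map_mul]
      exact .eta _
    | sup _ _ hx hy =>
      rw [mul_sup_eq]
      exact hx.sup hy
    | inf _ _ hx hy =>
      rw [mul_inf_eq]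
      exact hx.inf hy
  | sup _ _ hx hy =>
    rw [sup_mul_eq]
    exact hx.sup hy
  | inf _ _ hx hy =>
    rw [inf_mul_eq]
    exact hx.inf hy

/-- The free `ℓ`-group is generated by the image of `G` already as a lattice. -/
theorem inLattice (x : FreeLGroup E G) : InLattice x := by
  obtain ⟨s⟩ := x
  change InLattice (mk E s)
  induction s with
  | var a => exact .eta a
  | one =>
    have h : InLattice (eta E G 1) := .eta 1
    rwa [map_one] at h
  | mul s t hs ht => exact hs.mul ht
  | inv s hs => exact hs.inv
  | sup s t hs ht => exact hs.sup ht
  | inf s t hs ht => exact hs.inf ht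

/-- An `ℓ`-subgroup of the free `ℓ`-group that contains the image of `G` is everything. -/
theorem mem_of_eta_mem (K : LSubgroup (FreeLGroup E G)) (h : ∀ a, eta E G a ∈ K)
    (x : FreeLGroup E G) : x ∈ K := by
  induction inLattice x with
  | eta a => exact h a
  | sup _ _ hx hy => exact K.sup_mem' hx hy
  | inf _ _ hx hy => exact K.inf_mem' hx hy

end FreeLGroup

end FreeGeneration

/-! ### Convexity and the order on right cosets -/

namespace ConvexLSubgroup

variable {H : Type u} [Group H] [Lattice H] (K : ConvexLSubgroup H)

/-- The join is squeezed between `v` and `t ⊔ v`. This and its variants handle a join or meet of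
which only one operand is known to lie in `K`, the other being bounded on one side by an element of
`K`. -/
theorem sup_mem_of_le {u v t : H} (ht : t ∈ K) (hv : v ∈ K) (h : u ≤ t) : u ⊔ v ∈ K :=
  K.convex' hv (K.sup_mem' ht hv) le_sup_right (sup_le_sup_right h v)

theorem inf_mem_of_le {u v t : H} (ht : t ∈ K) (hv : v ∈ K) (h : t ≤ u) : u ⊓ v ∈ K :=
  K.convex' (K.inf_mem' ht hv) hv (inf_le_inf_right v h) inf_le_right

theorem sup_mem_of_le_right {u v t : H} (hu : u ∈ K) (ht : t ∈ K) (h : v ≤ t) : u ⊔ v ∈ K :=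
  K.convex' hu (K.sup_mem' hu ht) le_sup_left (sup_le_sup_left h u)

theorem inf_mem_of_le_right {u v t : H} (hu : u ∈ K) (ht : t ∈ K) (h : t ≤ v) : u ⊓ v ∈ K :=
  K.convex' (K.inf_mem' hu ht) hu (inf_le_inf_left u h) inf_le_left

variable [MulLeftMono H]

theorem coset_le_trans {x y z : H} (h : K.coset x ≤ K.coset y) (k : K.coset y ≤ K.coset z) :
    K.coset x ≤ K.coset z := by
  obtain ⟨s, hs, h⟩ := h
  obtain ⟨t, ht, k⟩ := k
  refine ⟨s * t, mul_mem hs ht, h.trans ?_⟩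
  rw [mul_assoc]
  exact mul_le_mul_right k s

theorem coset_le_mul [MulRightMono H] {x y : H} (z : H) (h : K.coset x ≤ K.coset y) :
    K.coset (x * z) ≤ K.coset (y * z) := by
  obtain ⟨t, ht, h⟩ := h
  refine ⟨t, ht, ?_⟩
  rw [← mul_assoc]
  exact mul_le_mul_left h z

/-- Antisymmetry of the coset order: the two inequalities trap `x * y⁻¹` between `t⁻¹` and `s`, and
convexity applies. -/
theorem mul_inv_mem_of_coset_le [MulRightMono H] {x y : H} (h : K.coset x ≤ K.coset y)
    (k : K.coset y ≤ K.coset x) : x * y⁻¹ ∈ K := by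
  obtain ⟨s, hs, h⟩ := h
  obtain ⟨t, ht, k⟩ := k
  refine K.convex' (inv_mem ht) hs ?_ (mul_inv_le_iff_le_mul.2 h)
  rw [le_mul_inv_iff_mul_le, inv_mul_le_iff_le_mul]
  exact k

theorem coset_le_of_mul_inv_mem {x y : H} (h : x * y⁻¹ ∈ K) : K.coset x ≤ K.coset y :=
  ⟨_, h, by simp⟩

/-- Turns an order condition on cosets into membership of a single element, which is what the
spectral topology can see. -/
theorem sup_one_mem_iff (x : H) : x ⊔ 1 ∈ K ↔ K.coset x ≤ K.coset 1 := by
  constructor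
  · intro h
    exact ⟨_, h, by simp⟩
  · rintro ⟨t, ht, h⟩
    rw [mul_one] at h
    exact K.sup_mem_of_le ht (one_mem K) h

end ConvexLSubgroup

/-! ### Classes of a right pre-order -/

variable {G : Type u} [Group G] [PartialOrder G]

theorem PreCone.cls_eq_cls (C : PreCone G) (a b : G) :
    C.cls a = C.cls b ↔ C.Rel a b ∧ C.Rel b a := by
  rw [le_antisymm_iff, C.cls_le_cls, C.cls_le_cls]

theorem PreCone.exists_cls (C : PreCone G) (w : C.Omega) : ∃ a, w = C.cls a := by
  obtain ⟨a⟩ := w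
  exact ⟨a, rfl⟩

theorem PreCone.mem_iff_rel (C : PreCone G) (a : G) : a ∈ C ↔ C.Rel 1 a := by
  unfold PreCone.Rel
  rw [inv_one, mul_one]

/-! ### From prime subgroups to right pre-orders -/

section PrimeToPreorder

variable {E : Equations} (p : Spec (FreeLGroup E G))

open FreeLGroup

theorem piRel_trans {a b c : G} (h : piRel p a b) (k : piRel p b c) : piRel p a c :=
  p.1.coset_le_trans h k

theorem piRel_mul_right {a b : G} (c : G) (h : piRel p a b) : piRel p (a * c) (b * c) := by
  unfold piRel
  rw [map_mul, map_mul]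
  exact p.1.coset_le_mul _ h

theorem piRel_iff_mem_piSet (a b : G) : piRel p a b ↔ b * a⁻¹ ∈ piSet p := by
  constructor
  · intro h
    have h1 := piRel_mul_right p a⁻¹ h
    rwa [mul_inv_cancel] at h1
  · intro h
    have h1 := piRel_mul_right p a (show piRel p 1 (b * a⁻¹) from h)
    rwa [one_mul, inv_mul_cancel_right] at h1

theorem piRel_of_le {a b : G} (h : a ≤ b) : piRel p a b :=
  ⟨1, one_mem p.1, by
    rw [_root_.one_mul]
    exact OrderHomClass.mono (eta E G) h⟩

theorem eta_mul_inv_mem_iff (a b : G) :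
    eta E G a * (eta E G b)⁻¹ ∈ p.1 ↔ piRel p a b ∧ piRel p b a := by
  constructor
  · intro h
    refine ⟨p.1.coset_le_of_mul_inv_mem h, p.1.coset_le_of_mul_inv_mem ?_⟩
    have h1 := inv_mem h
    rwa [mul_inv_rev, inv_inv] at h1
  · rintro ⟨h, k⟩
    exact p.1.mul_inv_mem_of_coset_le h k

/-- The right pre-order on `G` given by a prime subgroup of the free `ℓ`-group. -/
def Spec.toPreCone : PreCone G where
  carrier := piSet p
  one_mem' := piRel_of_le p le_rfl
  mul_mem' {a b} ha hb := by
    have h := piRel_mul_right p b (show piRel p 1 a from ha)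
    rw [one_mul] at h
    exact piRel_trans p hb h
  proper' h := by
    -- If all of `G` were positive, every `η(a)` would share the coset of `1`, so `p` would contain
    -- the generators and be all of the free `ℓ`-group.
    refine p.2.1 (Set.eq_univ_of_forall fun x => mem_of_eta_mem p.1.toLSubgroup (fun a => ?_) x)
    have h1 : ∀ a : G, a ∈ piSet p := fun a => h ▸ Set.mem_univ a
    have h2 := (eta_mul_inv_mem_iff p a 1).2
      ⟨(piRel_iff_mem_piSet p _ _).2 (h1 _), (piRel_iff_mem_piSet p _ _).2 (h1 _)⟩
    rwa [map_one, inv_one, _root_.mul_one] at h2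
  total' a := by
    rcases p.2.2 (p.1.coset (eta E G 1)) (p.1.coset (eta E G a)) with h | h
    · exact Or.inl h
    · right
      have h1 := (piRel_iff_mem_piSet p a 1).1 h
      rwa [one_mul] at h1
  pos_mem' a h := piRel_of_le p h

theorem Spec.toPreCone_rel (a b : G) : p.toPreCone.Rel a b ↔ piRel p a b :=
  (piRel_iff_mem_piSet p a b).symm

theorem Spec.toPreCone_cls_eq (a b : G) :
    p.toPreCone.cls a = p.toPreCone.cls b ↔ eta E G a * (eta E G b)⁻¹ ∈ p.1 := by
  rw [PreCone.cls_eq_cls, toPreCone_rel, toPreCone_rel, eta_mul_inv_mem_iff]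

/-- The automorphism `φ` of the chain of classes of `G` acts as right multiplication by `x` on
the corresponding right cosets. -/
def Spec.Acts (x : FreeLGroup E G) (φ : ChainAut p.toPreCone.Omega) : Prop :=
  ∀ a b, φ (p.toPreCone.cls a) = p.toPreCone.cls b → eta E G a * x * (eta E G b)⁻¹ ∈ p.1

namespace Spec.Acts

variable {p} {x y : FreeLGroup E G} {φ ψ : ChainAut p.toPreCone.Omega}

theorem rho (g : G) : p.Acts (eta E G g) (p.toPreCone.rho g) := by
  intro a b h
  rw [PreCone.rho_apply, toPreCone_cls_eq, map_mul] at h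
  exact h

theorem one : p.Acts 1 1 := by
  intro a b h
  rw [ChainAut.one_apply, toPreCone_cls_eq] at h
  rwa [_root_.mul_one]

theorem mul (h : p.Acts x φ) (k : p.Acts y ψ) : p.Acts (x * y) (φ * ψ) := by
  intro a b e
  obtain ⟨c, hc⟩ := p.toPreCone.exists_cls (φ (p.toPreCone.cls a))
  rw [ChainAut.mul_apply, hc] at e
  have h1 := mul_mem (h a c hc) (k c b e)
  simpa [_root_.mul_assoc] using h1

theorem inv (h : p.Acts x φ) : p.Acts x⁻¹ φ⁻¹ := by
  intro a b e
  have h1 := inv_mem (h b a (by rw [← e, ChainAut.apply_inv_self]))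
  simpa [_root_.mul_assoc] using h1

/-- With `φ[a] = [c]`, the element `η(a) x η(c)⁻¹` lies in `p`, and `[c] ≤ [b]` gives `η(c) ≤ t
η(b)` with `t ∈ p`; multiplying yields the bound. -/
theorem exists_le (h : p.Acts x φ) {a b : G}
    (e : φ (p.toPreCone.cls a) ≤ p.toPreCone.cls b) :
    ∃ t ∈ p.1, eta E G a * x * (eta E G b)⁻¹ ≤ t := by
  obtain ⟨c, hc⟩ := p.toPreCone.exists_cls (φ (p.toPreCone.cls a))
  rw [hc, PreCone.cls_le_cls, toPreCone_rel] at e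
  obtain ⟨t, ht, e⟩ := e
  refine ⟨_, mul_mem (h a c hc) ht, ?_⟩
  rw [_root_.mul_assoc _ _ t, mul_inv_le_iff_le_mul, _root_.mul_assoc _ _ (eta E G b)]
  have h1 := mul_le_mul_right e (eta E G a * x * (eta E G c)⁻¹)
  simpa [_root_.mul_assoc] using h1

theorem exists_ge (h : p.Acts x φ) {a b : G}
    (e : p.toPreCone.cls b ≤ φ (p.toPreCone.cls a)) :
    ∃ t ∈ p.1, t ≤ eta E G a * x * (eta E G b)⁻¹ := by
  -- The lower bound is the upper bound for `x⁻¹` and `φ⁻¹`, inverted.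
  have e' := φ⁻¹.mono e
  rw [ChainAut.inv_apply_self] at e'
  obtain ⟨t, ht, hle⟩ := h.inv.exists_le e'
  refine ⟨t⁻¹, inv_mem ht, inv_le_of_inv_le' ?_⟩
  simpa [_root_.mul_assoc] using hle

theorem mul_sup_mul (a b x y : FreeLGroup E G) : a * (x ⊔ y) * b = a * x * b ⊔ a * y * b := by
  rw [mul_sup_eq, sup_mul_eq]

theorem mul_inf_mul (a b x y : FreeLGroup E G) : a * (x ⊓ y) * b = a * x * b ⊓ a * y * b := by
  rw [mul_inf_eq, inf_mul_eq]

/-- In the chain, `[b]` is the larger of the images of `[a]` under `φ` and `ψ`. The operand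
attaining it contributes an element of `p`, the other is bounded above by an element of `p`, and
convexity puts the join in `p`. -/
theorem sup (h : p.Acts x φ) (k : p.Acts y ψ) : p.Acts (x ⊔ y) (φ ⊔ ψ) := by
  intro a b e
  rw [ChainAut.sup_apply] at e
  rw [mul_sup_mul]
  obtain ⟨s, hs, hs'⟩ := h.exists_le (le_sup_left.trans e.le)
  obtain ⟨t, ht, ht'⟩ := k.exists_le (le_sup_right.trans e.le)
  rcases le_total (φ (p.toPreCone.cls a)) (ψ (p.toPreCone.cls a)) with hle | hle
  · rw [sup_eq_right.2 hle] at e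
    exact p.1.sup_mem_of_le hs (k a b e) hs'
  · rw [sup_eq_left.2 hle] at e
    exact p.1.sup_mem_of_le_right (h a b e) ht ht'

theorem inf (h : p.Acts x φ) (k : p.Acts y ψ) : p.Acts (x ⊓ y) (φ ⊓ ψ) := by
  intro a b e
  rw [ChainAut.inf_apply] at e
  rw [mul_inf_mul]
  obtain ⟨s, hs, hs'⟩ := h.exists_ge (e.ge.trans inf_le_left)
  obtain ⟨t, ht, ht'⟩ := k.exists_ge (e.ge.trans inf_le_right)
  rcases le_total (φ (p.toPreCone.cls a)) (ψ (p.toPreCone.cls a)) with hle | hle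
  · rw [inf_eq_left.2 hle] at e
    exact p.1.inf_mem_of_le_right (h a b e) ht ht'
  · rw [inf_eq_right.2 hle] at e
    exact p.1.inf_mem_of_le hs (k a b e) hs'

/-- If `x` sends the coset of `η(a)` to those of `η(b)` and `η(c)`, these cosets coincide, and so do
the classes of `b` and `c`. -/
theorem unique (h : p.Acts x φ) (k : p.Acts x ψ) : φ = ψ := by
  apply ChainAut.ext
  intro w
  obtain ⟨a, rfl⟩ := p.toPreCone.exists_cls w
  obtain ⟨b, hb⟩ := p.toPreCone.exists_cls (φ (p.toPreCone.cls a))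
  obtain ⟨c, hc⟩ := p.toPreCone.exists_cls (ψ (p.toPreCone.cls a))
  rw [hb, hc, toPreCone_cls_eq]
  have h1 := mul_mem (inv_mem (h a b hb)) (k a c hc)
  simpa [_root_.mul_assoc] using h1

end Spec.Acts

/-- The automorphisms of the chain of classes that are induced by elements of the free
`ℓ`-group. -/
def Spec.inducedAut : LSubgroup (ChainAut p.toPreCone.Omega) where
  carrier := {φ | ∃ x, p.Acts x φ}
  mul_mem' := by
    rintro _ _ ⟨x, hx⟩ ⟨y, hy⟩
    exact ⟨_, hx.mul hy⟩
  one_mem' := ⟨_, Acts.one⟩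
  inv_mem' := by
    rintro _ ⟨x, hx⟩
    exact ⟨_, hx.inv⟩
  sup_mem' := by
    rintro _ _ ⟨x, hx⟩ ⟨y, hy⟩
    exact ⟨_, hx.sup hy⟩
  inf_mem' := by
    rintro _ _ ⟨x, hx⟩ ⟨y, hy⟩
    exact ⟨_, hx.inf hy⟩

/-- The induced automorphisms form an `ℓ`-subgroup containing the generators of `HSub`, hence all of
`HSub`. -/
theorem Spec.exists_acts (φ : p.toPreCone.HSub) :
    ∃ x, p.Acts x (φ : ChainAut p.toPreCone.Omega) :=
  φ.2 p.inducedAut (by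
    rintro _ ⟨a, rfl⟩
    exact ⟨_, Acts.rho a⟩)

theorem Spec.acts_eval {X : Type*} (f : X → FreeLGroup E G) (g : X → p.toPreCone.HSub)
    (h : ∀ n, p.Acts (f n) (g n : ChainAut p.toPreCone.Omega)) (s : LTerm X) :
    p.Acts (s.eval f) (s.eval g : p.toPreCone.HSub) := by
  induction s with
  | var n => exact h n
  | one => exact Acts.one
  | mul s t hs ht => exact hs.mul ht
  | inv s hs => exact hs.inv
  | sup s t hs ht => exact hs.sup ht
  | inf s t hs ht => exact hs.inf ht

/-- An assignment in `HSub` is lifted to the free `ℓ`-group. There the two sides of the equation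
have one value, and that value induces at most one automorphism. -/
theorem Spec.inVariety_toPreCone : InVariety E p.toPreCone.HSub := by
  intro e he g
  choose f hf using fun n => p.exists_acts (g n)
  apply Subtype.ext
  have h := p.acts_eval f g hf e.1
  rw [FreeLGroup.inVariety E G e he f] at h
  exact h.unique (p.acts_eval f g hf e.2)

/-- The right pre-order of a prime subgroup, as a point of the space of right pre-orders. -/
def Spec.toRightPreorder : RightPreorders E G := ⟨p.toPreCone, p.inVariety_toPreCone⟩

variable {p}

theorem Spec.piSet_subset {q : Spec (FreeLGroup E G)} (h : (p.1 : Set (FreeLGroup E G)) ⊆ q.1) :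
    piSet p ⊆ piSet q := by
  rintro a ⟨t, ht, k⟩
  exact ⟨t, h ht, k⟩

theorem Spec.toRightPreorder_mem_preorders (h : p ∈ SpecStar (FreeLGroup E G)) :
    p.toRightPreorder ∈ Preorders E G := by
  intro a b t e
  obtain ⟨s, hs, e⟩ := (p.toPreCone_rel a b).1 e
  -- Normality supplies the witness: `η(a) ≤ s η(b)` becomes `η(ta) ≤ (η(t) s η(t)⁻¹) η(tb)`.
  refine (p.toPreCone_rel _ _).2 ⟨eta E G t * s * (eta E G t)⁻¹, h.conj_mem s hs _, ?_⟩
  have h1 := mul_le_mul_right e (eta E G t)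
  simpa [_root_.mul_assoc] using h1

theorem Spec.continuous_toRightPreorder :
    Continuous (Spec.toRightPreorder : Spec (FreeLGroup E G) → RightPreorders E G) := by
  refine continuous_generateFrom_iff.2 ?_
  rintro _ ⟨a, rfl⟩
  -- By totality, strict positivity of `a` means only that `a⁻¹` is not positive, that is, that `p
  -- η(a) ≤ p` fails.
  refine ⟨{eta E G a ⊔ 1}, ?_⟩
  ext p
  change (a ∈ p.toPreCone ∧ a⁻¹ ∉ p.toPreCone) ↔ ¬ {eta E G a ⊔ 1} ⊆ (p.1 : Set (FreeLGroup E G))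
  have h : a⁻¹ ∈ p.toPreCone ↔ eta E G a ⊔ 1 ∈ p.1 := by
    have h1 := piRel_iff_mem_piSet p a 1
    rw [one_mul] at h1
    refine h1.symm.trans ?_
    unfold piRel
    rw [map_one]
    exact (p.1.sup_one_mem_iff (eta E G a)).symm
  rw [Set.singleton_subset_iff, SetLike.mem_coe, ← h]
  exact ⟨And.right, fun k => ⟨(p.toPreCone.total' a).resolve_right k, k⟩⟩

end PrimeToPreorder

variable [MulLeftMono G] [MulRightMono G] {E : Equations}

open FreeLGroup

/-! ### From right pre-orders to prime subgroups: stabilisers -/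

namespace RightPreorders

section Point

variable (C : RightPreorders E G)

/-- The automorphism of the chain of classes induced by an element of the free `ℓ`-group. -/
noncomputable def act (x : FreeLGroup E G) : ChainAut C.1.Omega := C.hom x

theorem act_eta (a : G) : C.act (eta E G a) = C.1.rho a := rfl

theorem act_one : C.act 1 = 1 := congrArg Subtype.val C.hom.map_one'

theorem act_mul (x y : FreeLGroup E G) : C.act (x * y) = C.act x * C.act y :=
  congrArg Subtype.val (C.hom.map_mul' x y)

theorem act_sup (x y : FreeLGroup E G) : C.act (x ⊔ y) = C.act x ⊔ C.act y :=
  congrArg Subtype.val (C.hom.map_sup' x y)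

theorem act_inf (x y : FreeLGroup E G) : C.act (x ⊓ y) = C.act x ⊓ C.act y :=
  congrArg Subtype.val (C.hom.map_inf' x y)

theorem act_mono : Monotone C.act := by
  intro x y h
  have e : x ⊔ y = y := sup_eq_right.2 h
  exact sup_eq_right.1 ((C.act_sup x y).symm.trans (congrArg C.act e))

/-- The image of the class of the identity under the automorphism induced by `x`. -/
noncomputable def orbit (x : FreeLGroup E G) : C.1.Omega := C.act x (C.1.cls 1)

theorem mem_kappaSet (x : FreeLGroup E G) : x ∈ kappaSet C ↔ C.orbit x = C.1.cls 1 := Iff.rfl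

theorem orbit_eta (a : G) : C.orbit (eta E G a) = C.1.cls a := by
  change C.1.rho a (C.1.cls 1) = C.1.cls a
  rw [PreCone.rho_apply, one_mul]

theorem orbit_one : C.orbit 1 = C.1.cls 1 := by
  unfold orbit
  rw [act_one, ChainAut.one_apply]

theorem orbit_mul (x y : FreeLGroup E G) : C.orbit (x * y) = C.act y (C.orbit x) := by
  unfold orbit
  rw [act_mul, ChainAut.mul_apply]

theorem orbit_sup (x y : FreeLGroup E G) : C.orbit (x ⊔ y) = C.orbit x ⊔ C.orbit y := by
  unfold orbit
  rw [act_sup, ChainAut.sup_apply]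

theorem orbit_inf (x y : FreeLGroup E G) : C.orbit (x ⊓ y) = C.orbit x ⊓ C.orbit y := by
  unfold orbit
  rw [act_inf, ChainAut.inf_apply]

theorem orbit_mono : Monotone C.orbit := fun _ _ h => C.act_mono h _

/-- The stabiliser of the class of the identity in the free `ℓ`-group. -/
noncomputable def stabilizer : ConvexLSubgroup (FreeLGroup E G) where
  carrier := kappaSet C
  mul_mem' {x y} hx hy := by
    rw [mem_kappaSet] at *
    rw [orbit_mul, hx]
    exact hy
  one_mem' := C.orbit_one
  inv_mem' {x} hx := by
    rw [mem_kappaSet] at *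
    have h := C.orbit_mul x x⁻¹
    rw [mul_inv_cancel, orbit_one, hx] at h
    exact h.symm
  sup_mem' {x y} hx hy := by
    change C.orbit (x ⊔ y) = _
    rw [orbit_sup, (C.mem_kappaSet x).1 hx, (C.mem_kappaSet y).1 hy, sup_idem]
  inf_mem' {x y} hx hy := by
    change C.orbit (x ⊓ y) = _
    rw [orbit_inf, (C.mem_kappaSet x).1 hx, (C.mem_kappaSet y).1 hy, inf_idem]
  convex' {x y z} hx hy hxz hzy := by
    have h1 := C.orbit_mono hxz
    have h2 := C.orbit_mono hzy
    rw [(C.mem_kappaSet x).1 hx] at h1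
    rw [(C.mem_kappaSet y).1 hy] at h2
    exact le_antisymm h2 h1

theorem mem_stabilizer (x : FreeLGroup E G) : x ∈ C.stabilizer ↔ C.orbit x = C.1.cls 1 := Iff.rfl

/-- The map `x ↦ [1]x` embeds the cosets of the stabiliser in the chain of classes as an ordered
set; primality and `π ∘ κ = id` both follow from this. -/
theorem stabilizer_coset_le (x y : FreeLGroup E G) :
    C.stabilizer.coset x ≤ C.stabilizer.coset y ↔ C.orbit x ≤ C.orbit y := by
  constructor
  · rintro ⟨t, ht, h⟩
    have h1 := C.orbit_mono h
    rwa [orbit_mul, (C.mem_stabilizer t).1 ht] at h1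
  · intro h
    -- Since `x * y⁻¹` moves `[1]` to a point at or below `[1]`, its join with `1` fixes `[1]`;
    -- multiplied by `y` it gives `x ⊔ y`, which is above `x`.
    refine ⟨x * y⁻¹ ⊔ 1, ?_, ?_⟩
    · rw [mem_stabilizer, orbit_sup, orbit_one, sup_eq_right, orbit_mul]
      have h1 := (C.act y⁻¹).mono h
      rwa [← orbit_mul C y, mul_inv_cancel, orbit_one] at h1
    · rw [sup_mul_eq, inv_mul_cancel_right]
      exact le_sup_left

theorem stabilizer_isPrime : C.stabilizer.IsPrime := by
  constructor
  · intro h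
    apply C.1.proper'
    refine Set.eq_univ_of_forall fun a => ?_
    have h1 : eta E G a ∈ (C.stabilizer : Set (FreeLGroup E G)) := h ▸ Set.mem_univ _
    have h2 := (C.mem_stabilizer _).1 h1
    rw [orbit_eta, PreCone.cls_eq_cls] at h2
    exact (C.1.mem_iff_rel a).2 h2.2
  · rintro ⟨x⟩ ⟨y⟩
    rcases le_total (C.orbit x) (C.orbit y) with h | h
    · exact Or.inl ((C.stabilizer_coset_le x y).2 h)
    · exact Or.inr ((C.stabilizer_coset_le y x).2 h)

/-- The stabiliser of the class of the identity, as a point of the spectrum. -/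
noncomputable def toSpec : Spec (FreeLGroup E G) := ⟨C.stabilizer, C.stabilizer_isPrime⟩

theorem toSpec_toRightPreorder : C.toSpec.toRightPreorder = C := by
  apply Subtype.ext
  apply SetLike.ext
  intro a
  change C.stabilizer.coset (eta E G 1) ≤ C.stabilizer.coset (eta E G a) ↔ a ∈ C.1
  rw [stabilizer_coset_le, orbit_eta, orbit_eta, PreCone.cls_le_cls, PreCone.mem_iff_rel]

end Point

theorem kappaSet_subset {C D : RightPreorders E G} (h : (C.1 : Set G) ⊆ D.1) :
    kappaSet C ⊆ kappaSet D := by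
  -- Enlarging the cone gives a monotone map of chains `[a]_C ↦ [a]_D`, which preserves `⊔` and `⊓`.
  -- Tracking arbitrary classes, not just `[1]`, is what lets the induction run.
  have key : ∀ x : FreeLGroup E G, ∀ a, C.orbit x = C.1.cls a → D.orbit x = D.1.cls a := by
    have hle : ∀ a b, C.1.cls a ≤ C.1.cls b → D.1.cls a ≤ D.1.cls b := fun a b e => h e
    have heq : ∀ a b, C.1.cls a = C.1.cls b → D.1.cls a = D.1.cls b :=
      fun a b e => le_antisymm (hle a b e.le) (hle b a e.ge)
    intro x
    induction inLattice x with
    | eta g =>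
      intro a e
      rw [orbit_eta] at *
      exact heq _ _ e
    | @sup x y _ _ hx hy =>
      intro a e
      obtain ⟨b, hb⟩ := C.1.exists_cls (C.orbit x)
      obtain ⟨c, hc⟩ := C.1.exists_cls (C.orbit y)
      rw [orbit_sup, hb, hc] at e
      rw [orbit_sup, hx b hb, hy c hc]
      rcases le_total (C.1.cls b) (C.1.cls c) with k | k
      · rw [sup_eq_right.2 k] at e
        rw [sup_eq_right.2 (hle _ _ k), heq _ _ e]
      · rw [sup_eq_left.2 k] at e
        rw [sup_eq_left.2 (hle _ _ k), heq _ _ e]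
    | @inf x y _ _ hx hy =>
      intro a e
      obtain ⟨b, hb⟩ := C.1.exists_cls (C.orbit x)
      obtain ⟨c, hc⟩ := C.1.exists_cls (C.orbit y)
      rw [orbit_inf, hb, hc] at e
      rw [orbit_inf, hx b hb, hy c hc]
      rcases le_total (C.1.cls b) (C.1.cls c) with k | k
      · rw [inf_eq_left.2 k] at e
        rw [inf_eq_left.2 (hle _ _ k), heq _ _ e]
      · rw [inf_eq_right.2 k] at e
        rw [inf_eq_right.2 (hle _ _ k), heq _ _ e]
  exact fun x hx => key x 1 hx

/-- For a two-sided pre-order the induced automorphisms commute with left translations. -/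
theorem act_cls_mul_left {C : RightPreorders E G} (h : C.1.IsPreorder) (x : FreeLGroup E G)
    (t a b : G) (e : C.act x (C.1.cls a) = C.1.cls b) :
    C.act x (C.1.cls (t * a)) = C.1.cls (t * b) := by
  have hle : ∀ a b, C.1.cls a ≤ C.1.cls b → C.1.cls (t * a) ≤ C.1.cls (t * b) :=
    fun a b e => h a b t e
  have heq : ∀ a b, C.1.cls a = C.1.cls b → C.1.cls (t * a) = C.1.cls (t * b) :=
    fun a b e => le_antisymm (hle a b e.le) (hle b a e.ge)
  -- The operands of a join or meet may send `[a]` to classes other than `[b]`, so the target has to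
  -- vary.
  induction inLattice x generalizing a b with
  | eta g =>
    rw [act_eta, PreCone.rho_apply] at *
    rw [mul_assoc]
    exact heq _ _ e
  | @sup x y _ _ hx hy =>
    obtain ⟨c, hc⟩ := C.1.exists_cls (C.act x (C.1.cls a))
    obtain ⟨d, hd⟩ := C.1.exists_cls (C.act y (C.1.cls a))
    rw [act_sup, ChainAut.sup_apply, hc, hd] at e
    rw [act_sup, ChainAut.sup_apply, hx a c hc, hy a d hd]
    rcases le_total (C.1.cls c) (C.1.cls d) with k | k
    · rw [sup_eq_right.2 k] at e
      rw [sup_eq_right.2 (hle _ _ k), heq _ _ e]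
    · rw [sup_eq_left.2 k] at e
      rw [sup_eq_left.2 (hle _ _ k), heq _ _ e]
  | @inf x y _ _ hx hy =>
    obtain ⟨c, hc⟩ := C.1.exists_cls (C.act x (C.1.cls a))
    obtain ⟨d, hd⟩ := C.1.exists_cls (C.act y (C.1.cls a))
    rw [act_inf, ChainAut.inf_apply, hc, hd] at e
    rw [act_inf, ChainAut.inf_apply, hx a c hc, hy a d hd]
    rcases le_total (C.1.cls c) (C.1.cls d) with k | k
    · rw [inf_eq_left.2 k] at e
      rw [inf_eq_left.2 (hle _ _ k), heq _ _ e]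
    · rw [inf_eq_right.2 k] at e
      rw [inf_eq_right.2 (hle _ _ k), heq _ _ e]

/-- Left translation by `a` carries the fixed point `[1]` to the fixed point `[a]`. Thus the
stabiliser is the kernel of the action, which makes it normal. -/
theorem act_eq_one_of_mem_stabilizer {C : RightPreorders E G} (h : C.1.IsPreorder)
    {x : FreeLGroup E G} (hx : x ∈ C.stabilizer) : C.act x = 1 := by
  apply ChainAut.ext
  intro w
  obtain ⟨a, rfl⟩ := C.1.exists_cls w
  have h1 := act_cls_mul_left h x a 1 1 hx
  rwa [mul_one] at h1

theorem toSpec_mem_specStar {C : RightPreorders E G} (h : C ∈ Preorders E G) :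
    C.toSpec ∈ SpecStar (FreeLGroup E G) where
  conj_mem x hx y := by
    change C.orbit (y * x * y⁻¹) = C.1.cls 1
    unfold orbit
    rw [act_mul, act_mul, act_eq_one_of_mem_stabilizer h hx, _root_.mul_one, ← act_mul,
      mul_inv_cancel, act_one, ChainAut.one_apply]

/-- For `x = η(a)` the two sets are the basic open sets of `a` and of `a⁻¹`. In a chain, comparing
`[1]` strictly with a join or meet is an "or" or an "and" of comparisons with the operands, so
openness passes through unions and finite intersections. -/
theorem isOpen_orbit (x : FreeLGroup E G) :
    IsOpen {C : RightPreorders E G | C.1.cls 1 < C.orbit x} ∧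
      IsOpen {C : RightPreorders E G | C.orbit x < C.1.cls 1} := by
  induction inLattice x with
  | eta a =>
    have key : ∀ a : G, IsOpen (basicOpen E a) := fun a =>
      TopologicalSpace.isOpen_generateFrom_of_mem ⟨a, rfl⟩
    constructor
    · convert key a using 1
      ext C
      change C.1.cls 1 < C.orbit _ ↔ a ∈ C.1 ∧ a⁻¹ ∉ C.1
      rw [orbit_eta, lt_iff_le_not_ge, PreCone.cls_le_cls, PreCone.cls_le_cls, PreCone.Rel,
        PreCone.Rel, inv_one, mul_one, one_mul]
    · convert key a⁻¹ using 1
      ext C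
      change C.orbit _ < C.1.cls 1 ↔ a⁻¹ ∈ C.1 ∧ a⁻¹⁻¹ ∉ C.1
      rw [orbit_eta, lt_iff_le_not_ge, PreCone.cls_le_cls, PreCone.cls_le_cls, PreCone.Rel,
        PreCone.Rel, inv_one, mul_one, one_mul, inv_inv]
  | sup _ _ hx hy =>
    simp only [orbit_sup, lt_sup_iff, sup_lt_iff]
    exact ⟨hx.1.union hy.1, hx.2.inter hy.2⟩
  | inf _ _ hx hy =>
    simp only [orbit_inf, lt_inf_iff, inf_lt_iff]
    exact ⟨hx.1.inter hy.1, hx.2.union hy.2⟩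

theorem continuous_toSpec : Continuous (toSpec : RightPreorders E G → _) := by
  constructor
  rintro _ ⟨A, rfl⟩
  -- Moving `[1]` means moving it strictly up or strictly down.
  have h : toSpec ⁻¹' Spec.support A = ⋃ x ∈ A,
      ({C : RightPreorders E G | C.1.cls 1 < C.orbit x} ∪ {C | C.orbit x < C.1.cls 1}) := by
    ext C
    simp only [Set.mem_iUnion, Set.mem_union, Set.mem_ofPred_eq, exists_prop]
    refine Set.not_subset.trans (exists_congr fun x => and_congr_right fun _ => ?_)
    exact ne_iff_lt_or_gt.trans or_comm
  rw [h]
  exact isOpen_biUnion fun x _ => (isOpen_orbit x).1.union (isOpen_orbit x).2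

end RightPreorders

/-! ### Recovering a prime subgroup from its right pre-order -/

namespace Spec

variable (p : Spec (FreeLGroup E G))

/-- Identifies the action through the universal property with right multiplication on cosets: both
agree on `η(G)` and respect `⊔` and `⊓`. -/
theorem acts_act (x : FreeLGroup E G) : p.Acts x (p.toRightPreorder.act x) := by
  induction inLattice x with
  | eta a => exact Acts.rho a
  | sup _ _ hx hy =>
    rw [RightPreorders.act_sup]
    exact hx.sup hy
  | inf _ _ hx hy =>
    rw [RightPreorders.act_inf]
    exact hx.inf hy

/-- If `x` sends `[1]` to `[b]`, then `x η(b)⁻¹ ∈ p`. Hence `x ∈ p` exactly when `η(b) ∈ p`, which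
says `[b] = [1]`, that is, `x` fixes `[1]`. -/
theorem toRightPreorder_toSpec : p.toRightPreorder.toSpec = p := by
  apply Subtype.ext
  apply SetLike.ext
  intro x
  obtain ⟨b, hb⟩ := p.toPreCone.exists_cls (p.toRightPreorder.orbit x)
  have h := p.acts_act x 1 b hb
  rw [map_one, _root_.one_mul] at h
  have hx : p.toRightPreorder.orbit x = p.toPreCone.cls 1 ↔ eta E G b ∈ p.1 := by
    have h1 := p.toPreCone_cls_eq b 1
    rw [map_one, inv_one, _root_.mul_one] at h1
    rw [hb]
    exact h1
  refine Iff.trans hx ?_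
  constructor
  · intro k
    have h1 := mul_mem h k
    rwa [inv_mul_cancel_right] at h1
  · intro k
    have h1 := mul_mem (inv_mem h) k
    rwa [mul_inv_rev, inv_inv, inv_mul_cancel_right] at h1

end Spec

end LGrp

/-! ### Restriction of homeomorphisms and assembly -/

theorem isHomeomorph_mapsTo_restrict {X Y : Type*} [TopologicalSpace X] [TopologicalSpace Y]
    {f : X → Y} {g : Y → X} (hf : Continuous f) (hg : Continuous g)
    (hgf : Function.LeftInverse g f) (hfg : Function.RightInverse g f) {s : Set X} {t : Set Y}
    (hs : Set.MapsTo f s t) (ht : Set.MapsTo g t s) : IsHomeomorph (hs.restrict f s t) :=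
  isHomeomorph_iff_exists_inverse.2 ⟨hf.restrict hs, ht.restrict g t s,
    fun x => Subtype.ext (hgf x), fun y => Subtype.ext (hfg y), hg.restrict ht⟩

theorem theorem2p5 (G : Type u) [Group G] [PartialOrder G] [MulLeftMono G] [MulRightMono G]
    (E : Equations) :
    ∃ (κ : RightPreorders E G → Spec (FreeLGroup E G))
      (π : Spec (FreeLGroup E G) → RightPreorders E G),
      -- the two maps are the ones given by the explicit formulas
      (∀ C, ((κ C).1 : Set (FreeLGroup E G)) = kappaSet C) ∧
      (∀ p, ((π p).1 : Set G) = piSet p) ∧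
      (∀ p a b, (π p).1.Rel a b ↔ piRel p a b) ∧
      -- mutually inverse
      Function.LeftInverse π κ ∧ Function.RightInverse π κ ∧
      -- inclusion-preserving
      (∀ C D, (C.1 : Set G) ⊆ D.1 → ((κ C).1 : Set (FreeLGroup E G)) ⊆ (κ D).1) ∧
      (∀ p q, (p.1 : Set (FreeLGroup E G)) ⊆ q.1 → ((π p).1 : Set G) ⊆ (π q).1) ∧
      -- homeomorphisms
      IsHomeomorph κ ∧ IsHomeomorph π ∧
      -- the restrictions to pre-orders and prime ideals
      ∃ (hκ : Set.MapsTo κ (Preorders E G) (SpecStar (FreeLGroup E G)))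
        (hπ : Set.MapsTo π (SpecStar (FreeLGroup E G)) (Preorders E G)),
        IsHomeomorph (hκ.restrict κ _ _) ∧ IsHomeomorph (hπ.restrict π _ _) := by
  refine ⟨RightPreorders.toSpec, Spec.toRightPreorder, fun _ => rfl, fun _ => rfl,
    Spec.toPreCone_rel, RightPreorders.toSpec_toRightPreorder, Spec.toRightPreorder_toSpec,
    fun _ _ => RightPreorders.kappaSet_subset, fun _ _ => Spec.piSet_subset,
    isHomeomorph_iff_exists_inverse.2 ⟨RightPreorders.continuous_toSpec, _,
      RightPreorders.toSpec_toRightPreorder, Spec.toRightPreorder_toSpec,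
      Spec.continuous_toRightPreorder⟩,
    isHomeomorph_iff_exists_inverse.2 ⟨Spec.continuous_toRightPreorder, _,
      Spec.toRightPreorder_toSpec, RightPreorders.toSpec_toRightPreorder,
      RightPreorders.continuous_toSpec⟩,
    fun _ => RightPreorders.toSpec_mem_specStar, fun _ => Spec.toRightPreorder_mem_preorders,
    isHomeomorph_mapsTo_restrict RightPreorders.continuous_toSpec Spec.continuous_toRightPreorder
      RightPreorders.toSpec_toRightPreorder Spec.toRightPreorder_toSpec _
      fun _ => Spec.toRightPreorder_mem_preorders,
    isHomeomorph_mapsTo_restrict Spec.continuous_toRightPreorder RightPreorders.continuous_toSpec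
      Spec.toRightPreorder_toSpec RightPreorders.toSpec_toRightPreorder _
      fun _ => RightPreorders.toSpec_mem_specStar⟩
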